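/- Let $\mathrm{IN}(x,y)=(x_0\wedge y_0)\vee(x_1\wedge y_1)\vee\cdots\vee(x_{n-1}\wedge y_{n-1})$ for $x,y\in\{0,1\}^n$. In a quantum communication protocol Alice holds $x$, Bob holds $y$, and there is a system of finitely many qubits, initially in the state $|0\cdots0\rangle$, each in the possession of Alice or of Bob. Following a schedule that is fixed in advance, each party can apply unitary transformations, which may depend on that party's input only, to the qubits in its possession, and can send qubits to the other party. At the end, the output bit is the outcome of a measurement of Bob's qubits. The communication is the total number of qubits sent. **Theorem.** There is a constant $C>0$ such that for every integer $n\ge 2$ and every $0<\varepsilon<1$ there is a quantum communication protocol with $n$-bit inputs that uses at most $C\sqrt{n\log(1/\varepsilon)}\,\log n$ qubits of communication and whose output, for every pair of inputs $x,y\in\{0,1\}^n$, differs from $\mathrm{IN}(x,y)$ with probability at most $\varepsilon$. -/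

import Mathlib

/-- The two parties of a communication protocol. -/
inductive Party : Type
  | alice
  | bob
  deriving DecidableEq

namespace Party

/-- The other party. -/
def other : Party → Party
  | alice => bob
  | bob => alice

end Party

namespace QComm

/-- An `n`-bit binary string. -/
abbrev Bits (n : ℕ) : Type := Fin n → Bool

/-- A vector of amplitudes for `m` qubits, indexed by the computational basis. -/
abbrev QState (m : ℕ) : Type := (Fin m → Bool) → ℂ

/-- An assignment of every qubit to the party that possesses it. -/
abbrev Ownership (m : ℕ) : Type := Fin m → Party

/-- The qubits in the possession of party `p`. -/
abbrev Possessed {m : ℕ} (own : Ownership m) (p : Party) : Type := {i : Fin m // own i = p}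

/-- The operator `V ⊗ I` on all `m` qubits, where `V` acts on the qubits in the possession of `p`
and `I` is the identity on the remaining qubits. -/
noncomputable def localize {m : ℕ} (own : Ownership m) (p : Party)
    (V : Matrix (Possessed own p → Bool) (Possessed own p → Bool) ℂ) :
    Matrix (Fin m → Bool) (Fin m → Bool) ℂ :=
  Matrix.of fun s t =>
    if ∀ i, own i ≠ p → s i = t i then V (fun i => s i.1) (fun i => t i.1) else 0

/-- `U` is a unitary transformation of the qubits in the possession of `p`. -/
def IsLocalUnitary {m : ℕ} (own : Ownership m) (p : Party)
    (U : Matrix (Fin m → Bool) (Fin m → Bool) ℂ) : Prop :=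
  ∃ V ∈ Matrix.unitaryGroup (Possessed own p → Bool) ℂ, U = localize own p V

/-- An elementary step of a protocol with `n`-bit inputs and `m` qubits: either party `p` applies
a transformation that depends on the input of `p` (and not on the input of the other party),
or the party in possession of qubit `i` sends it to the other party. -/
inductive Step (n m : ℕ) : Type
  | apply (p : Party) (U : Bits n → Matrix (Fin m → Bool) (Fin m → Bool) ℂ)
  | send (i : Fin m)

/-- The ownership of the qubits after a step. -/
def Step.newOwner {n m : ℕ} (own : Ownership m) : Step n m → Ownership m
  | .apply _ _ => own
  | .send i => Function.update own i (own i).other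

/-- The step is allowed when the qubits are distributed according to `own`. -/
def Step.Legal {n m : ℕ} (own : Ownership m) : Step n m → Prop
  | .apply p U => ∀ z : Bits n, IsLocalUnitary own p (U z)
  | .send _ => True

/-- The number of qubits communicated in a step. -/
def Step.cost {n m : ℕ} : Step n m → ℕ
  | .apply _ _ => 0
  | .send _ => 1

/-- The effect of a step on the joint state, on input `x` for Alice and `y` for Bob. -/
noncomputable def Step.act {n m : ℕ} (x y : Bits n) (ψ : QState m) : Step n m → QState m
  | .apply .alice U => (U x).mulVec ψ
  | .apply .bob U => (U y).mulVec ψ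
  | .send _ => ψ

/-- The ownership of the qubits after a list of steps. -/
def finalOwner {n m : ℕ} (own : Ownership m) (l : List (Step n m)) : Ownership m :=
  l.foldl Step.newOwner own

/-- Every step of the list is allowed at the time it is performed. -/
def Legal {n m : ℕ} : Ownership m → List (Step n m) → Prop
  | _, [] => True
  | own, a :: l => a.Legal own ∧ Legal (a.newOwner own) l

/-- The state `|0…0⟩`. -/
def zeroState (m : ℕ) : QState m := Pi.single (fun _ => false) 1

/-- A two-party quantum communication protocol with `n`-bit inputs. The qubits start in the state
`|0…0⟩`; the parties transform the qubits they possess and send qubits to each other; in the end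
Bob measures one of his qubits in the computational basis, and the outcome is the output. (Bob can
apply any unitary transformation to his qubits before this, so that any two-outcome measurement of
his qubits can be carried out.) -/
structure Protocol (n : ℕ) where
  /-- The number of qubits. -/
  m : ℕ
  /-- The initial distribution of the qubits. -/
  start : Ownership m
  /-- The steps, in the order in which they are performed. -/
  steps : List (Step n m)
  legal : Legal start steps
  /-- The qubit whose measurement yields the output. -/
  out : Fin m
  out_bob : finalOwner start steps out = Party.bob

namespace Protocol

/-- The total number of qubits communicated, in both directions. -/
def communication {n : ℕ} (P : Protocol n) : ℕ := (P.steps.map Step.cost).sum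

/-- The state at the end of the protocol, just before the measurement. -/
noncomputable def finalState {n : ℕ} (P : Protocol n) (x y : Bits n) : QState P.m :=
  P.steps.foldl (Step.act x y) (zeroState P.m)

/-- The probability that the output on input `(x, y)` is `b`. -/
noncomputable def outputProb {n : ℕ} (P : Protocol n) (x y : Bits n) (b : Bool) : ℝ :=
  ∑ s : Fin P.m → Bool, if s P.out = b then ‖P.finalState x y s‖ ^ 2 else 0

/-- On every input, the output differs from `f x y` with probability at most `ε`. -/
def ErrsAtMost {n : ℕ} (P : Protocol n) (f : Bits n → Bits n → Bool) (ε : ℝ) : Prop :=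
  ∀ x y : Bits n, P.outputProb x y (!(f x y)) ≤ ε

end Protocol

/-- The intersection function `(x₀ ∧ y₀) ∨ ⋯ ∨ (xₙ₋₁ ∧ yₙ₋₁)`. -/
def IN {n : ℕ} (x y : Bits n) : Bool := decide (∃ i : Fin n, (x i && y i) = true)

end QComm

/-! Grover search over the positions `i` with `x i = y i = 1` is run as a protocol. Bob holds a
register of O(log n) qubits. One query costs one round trip: Bob writes his marking bit into a work
qubit, Alice applies the phase, Bob erases the bit. A last round trip checks the sampled address, so
disjoint inputs never yield `true` (`computes_grover`). With t marked addresses among N, the output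
is wrongly `false` with probability cos² of (2j+1) times the Grover angle. An extra biased qubit
lowers the marked amplitude by a factor a, so the search can be tuned to be exact for one guessed t
= s; it then still errs with probability at most 9/10 when s/4 ≤ t ≤ s (`exists_search`).

Plain repetition would cost √n · log(1/ε). Instead, with T = 4^u about log(1/ε), one exact search is
made for each t ≤ T; since the sum of √(N/t) is at most 2√(NT), small t are excluded without error.
For t > T each guess 4^k > T is tried 10T times; the cost is a geometric sum, again O(√(NT))
queries, and the error is at most e^(-T). Outputs are joined by disjunction, under which the
probabilities of `false` multiply (`Computes.mul`, `exists_combined_search`). Each query costs O(log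
n) qubits. -/

namespace QComm

/-! ### Operators on a subset of the qubits, and basic unitaries -/

section Lift

variable {κ ι θ : Type*}

open Classical in
/-- The operator `V ⊗ I`, where `V` acts on the qubits in the range of `e`. -/
noncomputable def lift (e : κ → ι) (V : Matrix (κ → Bool) (κ → Bool) ℂ) :
    Matrix (ι → Bool) (ι → Bool) ℂ :=
  Matrix.of fun s t => if ∀ i, i ∉ Set.range e → s i = t i then V (s ∘ e) (t ∘ e) else 0

theorem localize_eq_lift {m : ℕ} (own : Ownership m) (p : Party)
    (V : Matrix (Possessed own p → Bool) (Possessed own p → Bool) ℂ) :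
    localize own p V = lift (Subtype.val : Possessed own p → Fin m) V := by
  classical
  ext s t
  simp only [localize, lift, Matrix.of_apply, Subtype.range_coe_subtype, Set.mem_ofPred_eq]
  exact if_congr Iff.rfl rfl rfl

theorem lift_lift {f : θ → κ} {e : κ → ι} (he : Function.Injective e)
    (V : Matrix (θ → Bool) (θ → Bool) ℂ) : lift e (lift f V) = lift (e ∘ f) V := by
  ext s t
  have key : (∀ i, i ∉ Set.range (e ∘ f) → s i = t i) ↔
      (∀ i, i ∉ Set.range e → s i = t i) ∧
        ∀ k, k ∉ Set.range f → (s ∘ e) k = (t ∘ e) k := by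
    constructor
    · refine fun h => ⟨fun i hi => h i ?_, fun k hk => h (e k) ?_⟩
      · rintro ⟨j, rfl⟩
        exact hi ⟨f j, rfl⟩
      · rintro ⟨j, hj⟩
        exact hk ⟨j, he hj⟩
    · rintro ⟨h1, h2⟩ i hi
      by_cases h : i ∈ Set.range e
      · obtain ⟨k, rfl⟩ := h
        refine h2 k ?_
        rintro ⟨j, rfl⟩
        exact hi ⟨j, rfl⟩
      · exact h1 i h
  simp only [lift, Matrix.of_apply]
  by_cases h1 : ∀ i, i ∉ Set.range e → s i = t i
  · by_cases h2 : ∀ k, k ∉ Set.range f → (s ∘ e) k = (t ∘ e) k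
    · rw [if_pos h1, if_pos h2, if_pos (key.2 ⟨h1, h2⟩)]
      rfl
    · rw [if_pos h1, if_neg h2, if_neg fun h => h2 (key.1 h).2]
  · rw [if_neg h1, if_neg fun h => h1 (key.1 h).1]

/-- The matrix entry vanishes unless both strings agree off the range of `e`, so only strings
`Function.extend e v s`, with the bits of `s` on that range replaced by `v`, contribute. -/
theorem lift_mulVec_apply [Fintype κ] [Fintype ι] [DecidableEq κ] [DecidableEq ι]
    {e : κ → ι} (he : Function.Injective e)
    (V : Matrix (κ → Bool) (κ → Bool) ℂ) (φ : (ι → Bool) → ℂ) (s : ι → Bool) :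
    (lift e V).mulVec φ s = ∑ v, V (s ∘ e) v * φ (Function.extend e v s) := by
  classical
  simp only [Matrix.mulVec, dotProduct, lift, Matrix.of_apply, ite_mul, zero_mul]
  rw [← Finset.sum_filter]
  refine Finset.sum_nbij' (fun u => u ∘ e) (fun v => Function.extend e v s)
    (fun _ _ => Finset.mem_univ _) ?_ ?_ ?_ ?_
  · intro v _
    rw [Finset.mem_filter]
    exact ⟨Finset.mem_univ _, fun i hi => (Function.extend_apply' _ _ _ hi).symm⟩
  · intro u hu
    rw [Finset.mem_filter] at hu
    funext i
    by_cases h : i ∈ Set.range e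
    · obtain ⟨k, rfl⟩ := h
      rw [he.extend_apply]; rfl
    · rw [Function.extend_apply' _ _ _ h, hu.2 i h]
  · intro v _
    exact Function.extend_comp he v s
  · intro u hu
    rw [Finset.mem_filter] at hu
    congr 2
    funext i
    by_cases h : i ∈ Set.range e
    · obtain ⟨k, rfl⟩ := h
      rw [he.extend_apply]; rfl
    · rw [Function.extend_apply' _ _ _ h, hu.2 i h]

/-- The factor `χ` ignores the qubits acted on and is carried along as a spectator; this lets
subprotocols be analysed on their own register. -/
theorem lift_mulVec_mul [Fintype κ] [Fintype ι] [DecidableEq κ] [DecidableEq ι]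
    {e : κ → ι} (he : Function.Injective e)
    (V : Matrix (κ → Bool) (κ → Bool) ℂ) (ψ : (κ → Bool) → ℂ) (χ : (ι → Bool) → ℂ)
    (hχ : ∀ v s, χ (Function.extend e v s) = χ s) :
    (lift e V).mulVec (fun s => ψ (s ∘ e) * χ s) =
      fun s => V.mulVec ψ (s ∘ e) * χ s := by
  funext s
  rw [lift_mulVec_apply he]
  simp only [Function.extend_comp he, hχ, Matrix.mulVec, dotProduct, Finset.sum_mul, mul_assoc]

theorem lift_mul [Fintype κ] [Fintype ι] [DecidableEq κ] [DecidableEq ι]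
    {e : κ → ι} (he : Function.Injective e)
    (A B : Matrix (κ → Bool) (κ → Bool) ℂ) : lift e A * lift e B = lift e (A * B) := by
  ext s t
  change (lift e A).mulVec (fun u => lift e B u t) s = _
  rw [lift_mulVec_apply he]
  have key : ∀ v, (∀ i, i ∉ Set.range e → Function.extend e v s i = t i) ↔
      ∀ i, i ∉ Set.range e → s i = t i := fun v =>
    forall₂_congr fun i hi => by rw [Function.extend_apply' _ _ _ hi]
  simp only [lift, Matrix.of_apply, key, Function.extend_comp he, Matrix.mul_apply]
  split_ifs <;> simp

theorem lift_one [Fintype κ] [Fintype ι] [DecidableEq ι] [DecidableEq κ] (e : κ → ι) :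
    lift e (1 : Matrix (κ → Bool) (κ → Bool) ℂ) = 1 := by
  ext s t
  simp only [lift, Matrix.of_apply, Matrix.one_apply]
  by_cases hst : s = t
  · subst hst
    simp
  · rw [if_neg hst]
    split_ifs with h1 h2
    · refine absurd (funext fun i => ?_) hst
      by_cases h : i ∈ Set.range e
      · obtain ⟨k, rfl⟩ := h
        exact congrFun h2 k
      · exact h1 i h
    · rfl
    · rfl

theorem lift_star (e : κ → ι) (V : Matrix (κ → Bool) (κ → Bool) ℂ) :
    star (lift e V) = lift e (star V) := by
  ext s t
  simp only [lift, Matrix.star_apply, Matrix.of_apply]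
  by_cases h : ∀ i, i ∉ Set.range e → s i = t i
  · rw [if_pos h, if_pos fun i hi => (h i hi).symm]
  · rw [if_neg h, if_neg fun h' => h fun i hi => (h' i hi).symm, star_zero]

theorem lift_mem_unitaryGroup [Fintype κ] [Fintype ι] [DecidableEq κ] [DecidableEq ι]
    {e : κ → ι}
    (he : Function.Injective e) {V : Matrix (κ → Bool) (κ → Bool) ℂ}
    (hV : V ∈ Matrix.unitaryGroup (κ → Bool) ℂ) :
    lift e V ∈ Matrix.unitaryGroup (ι → Bool) ℂ := by
  rw [Matrix.mem_unitaryGroup_iff] at hV ⊢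
  rw [lift_star, lift_mul he, hV, lift_one]

end Lift

theorem IsLocalUnitary.lift {m m' : ℕ} {own : Ownership m} {own' : Ownership m'} {p : Party}
    {e : Fin m → Fin m'} (he : Function.Injective e) (ho : ∀ i, own' (e i) = own i)
    {U : Matrix (Fin m → Bool) (Fin m → Bool) ℂ} (hU : IsLocalUnitary own p U) :
    IsLocalUnitary own' p (QComm.lift e U) := by
  obtain ⟨V, hV, rfl⟩ := hU
  let e' : Possessed own p → Possessed own' p := fun i => ⟨e i.1, (ho i.1).trans i.2⟩
  have he' : Function.Injective e' := fun i j h =>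
    Subtype.ext (he (congrArg Subtype.val h))
  refine ⟨QComm.lift e' V, lift_mem_unitaryGroup he' hV, ?_⟩
  rw [localize_eq_lift, localize_eq_lift, lift_lift he, lift_lift Subtype.val_injective]
  rfl

/-- Locality is no restriction while one party holds the whole register, which is why the search
sends all its qubits back and forth. -/
theorem isLocalUnitary_of_forall_eq {m : ℕ} {own : Ownership m} {p : Party}
    (ho : ∀ i, own i = p) {U : Matrix (Fin m → Bool) (Fin m → Bool) ℂ}
    (hU : U ∈ Matrix.unitaryGroup (Fin m → Bool) ℂ) : IsLocalUnitary own p U := by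
  let e : Fin m → Possessed own p := fun i => ⟨i, ho i⟩
  have he : Function.Injective e := fun i j h => congrArg Subtype.val h
  refine ⟨lift e U, lift_mem_unitaryGroup he hU, ?_⟩
  rw [localize_eq_lift, lift_lift Subtype.val_injective]
  ext s t
  simp only [lift, Matrix.of_apply]
  rw [if_pos]
  · rfl
  · intro i hi
    exact absurd ⟨i, rfl⟩ hi

theorem IsLocalUnitary.mem_unitaryGroup {m : ℕ} {own : Ownership m} {p : Party}
    {U : Matrix (Fin m → Bool) (Fin m → Bool) ℂ} (hU : IsLocalUnitary own p U) :
    U ∈ Matrix.unitaryGroup (Fin m → Bool) ℂ := by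
  obtain ⟨V, hV, rfl⟩ := hU
  rw [localize_eq_lift]
  exact lift_mem_unitaryGroup Subtype.val_injective hV

theorem sum_norm_sq_mulVec {β : Type*} [Fintype β] [DecidableEq β] {U : Matrix β β ℂ}
    (hU : U ∈ Matrix.unitaryGroup β ℂ) (ψ : β → ℂ) :
    ∑ s, ‖U.mulVec ψ s‖ ^ 2 = ∑ s, ‖ψ s‖ ^ 2 := by
  have key : ∀ φ : β → ℂ, ((∑ s, ‖φ s‖ ^ 2 : ℝ) : ℂ) = star φ ⬝ᵥ φ := by
    intro φ
    simp only [dotProduct, Pi.star_apply, Complex.ofReal_sum, Complex.ofReal_pow]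
    exact Finset.sum_congr rfl fun s _ => (Complex.conj_mul' (φ s)).symm
  have h : star (U.mulVec ψ) ⬝ᵥ U.mulVec ψ = star ψ ⬝ᵥ ψ := by
    rw [Matrix.star_mulVec, Matrix.dotProduct_mulVec, Matrix.vecMul_vecMul,
      ← Matrix.star_eq_conjTranspose, Matrix.mem_unitaryGroup_iff'.1 hU, Matrix.vecMul_one]
  exact_mod_cast (key _).trans (h.trans (key _).symm)

/-- The operator that permutes the computational basis by the involution `σ`. -/
def basisPerm {β : Type*} [DecidableEq β] (σ : β → β) : Matrix β β ℂ :=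
  Matrix.of fun s t => if σ s = t then 1 else 0

theorem basisPerm_mulVec {β : Type*} [Fintype β] [DecidableEq β] (σ : β → β) (ψ : β → ℂ) :
    (basisPerm σ).mulVec ψ = fun s => ψ (σ s) := by
  funext s
  simp [basisPerm, Matrix.mulVec, dotProduct]

theorem basisPerm_mem_unitaryGroup {β : Type*} [Fintype β] [DecidableEq β] {σ : β → β}
    (hσ : Function.Involutive σ) : basisPerm σ ∈ Matrix.unitaryGroup β ℂ := by
  rw [Matrix.mem_unitaryGroup_iff]
  ext s t
  simp only [basisPerm, Matrix.mul_apply, Matrix.of_apply, Matrix.star_apply, Matrix.one_apply,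
    ite_mul, one_mul, zero_mul, Finset.sum_ite_eq, Finset.mem_univ, if_true]
  rw [apply_ite star, star_one, star_zero]
  exact if_congr (hσ.injective.eq_iff.trans eq_comm) rfl rfl

/-! ### Concatenation of protocols and conservation of norm -/

section Append

variable {n m : ℕ}

theorem finalOwner_append (own : Ownership m) (l₁ l₂ : List (Step n m)) :
    finalOwner own (l₁ ++ l₂) = finalOwner (finalOwner own l₁) l₂ :=
  List.foldl_append

theorem legal_append (own : Ownership m) (l₁ l₂ : List (Step n m)) :
    Legal own (l₁ ++ l₂) ↔ Legal own l₁ ∧ Legal (finalOwner own l₁) l₂ := by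
  induction l₁ generalizing own with
  | nil => simp [Legal, finalOwner]
  | cons a l ih =>
    simp only [List.cons_append, Legal, ih, and_assoc]
    rfl

theorem Step.sum_norm_sq_act {own : Ownership m} (x y : Bits n) (ψ : QState m) {a : Step n m}
    (ha : a.Legal own) : ∑ s, ‖Step.act x y ψ a s‖ ^ 2 = ∑ s, ‖ψ s‖ ^ 2 := by
  cases a with
  | send i => rfl
  | apply p U =>
    cases p with
    | alice => exact sum_norm_sq_mulVec (ha x).mem_unitaryGroup ψ
    | bob => exact sum_norm_sq_mulVec (ha y).mem_unitaryGroup ψ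

theorem sum_norm_sq_foldl {own : Ownership m} (x y : Bits n) (ψ : QState m)
    {l : List (Step n m)} (hl : Legal own l) :
    ∑ s, ‖l.foldl (Step.act x y) ψ s‖ ^ 2 = ∑ s, ‖ψ s‖ ^ 2 := by
  induction l generalizing own ψ with
  | nil => rfl
  | cons a l ih => exact (ih _ hl.2).trans (Step.sum_norm_sq_act x y ψ hl.1)

theorem Protocol.outputProb_add (P : Protocol n) (x y : Bits n) :
    P.outputProb x y true + P.outputProb x y false = 1 := by
  have h := sum_norm_sq_foldl x y (zeroState P.m) P.legal
  have h0 : ∑ s, ‖zeroState P.m s‖ ^ 2 = 1 := by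
    rw [Finset.sum_eq_single (fun _ => false)]
    · simp [zeroState]
    · intro s _ hs
      simp [zeroState, Pi.single_eq_of_ne hs]
    · exact fun h => absurd (Finset.mem_univ _) h
  rw [h0] at h
  rw [← h, Protocol.outputProb, Protocol.outputProb, ← Finset.sum_add_distrib]
  refine Finset.sum_congr rfl fun s _ => ?_
  cases hs : s P.out <;> simp [Protocol.finalState]

end Append

/-! ### Running a protocol inside a larger register -/

section LiftStep

variable {n m m' : ℕ}

/-- The step `a` performed on the qubits in the range of `e`. -/
noncomputable def Step.lift (e : Fin m → Fin m') : Step n m → Step n m'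
  | .apply p U => .apply p fun z => QComm.lift e (U z)
  | .send i => .send (e i)

theorem Step.cost_lift (e : Fin m → Fin m') (a : Step n m) : (a.lift e).cost = a.cost := by
  cases a <;> rfl

theorem sum_cost_map_lift (e : Fin m → Fin m') (l : List (Step n m)) :
    ((l.map (Step.lift e)).map Step.cost).sum = (l.map Step.cost).sum := by
  rw [List.map_map]
  exact congrArg List.sum (List.map_congr_left fun a _ => Step.cost_lift e a)

theorem Step.newOwner_lift {e : Fin m → Fin m'} (he : Function.Injective e) {own : Ownership m}
    {own' : Ownership m'} (ho : ∀ i, own' (e i) = own i) (a : Step n m) (i : Fin m) :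
    (a.lift e).newOwner own' (e i) = a.newOwner own i := by
  cases a with
  | apply p U => exact ho i
  | send j =>
    change Function.update own' (e j) (own' (e j)).other (e i) =
      Function.update own j (own j).other i
    rw [Function.update_apply, Function.update_apply, ho, ho]
    simp only [he.eq_iff]

theorem Step.newOwner_lift_of_notMem {e : Fin m → Fin m'} (own' : Ownership m') (a : Step n m)
    {i : Fin m'} (hi : i ∉ Set.range e) : (a.lift e).newOwner own' i = own' i := by
  cases a with
  | apply p U => rfl
  | send j => exact Function.update_of_ne (fun h => hi ⟨j, h.symm⟩) _ _

theorem finalOwner_map_lift {e : Fin m → Fin m'} (he : Function.Injective e) {own : Ownership m}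
    {own' : Ownership m'} (ho : ∀ i, own' (e i) = own i) (l : List (Step n m)) (i : Fin m) :
    finalOwner own' (l.map (Step.lift e)) (e i) = finalOwner own l i := by
  induction l generalizing own own' with
  | nil => exact ho i
  | cons a l ih => exact ih (Step.newOwner_lift he ho a)

theorem finalOwner_map_lift_of_notMem {e : Fin m → Fin m'} (own' : Ownership m')
    (l : List (Step n m)) {i : Fin m'} (hi : i ∉ Set.range e) :
    finalOwner own' (l.map (Step.lift e)) i = own' i := by
  induction l generalizing own' with
  | nil => rfl
  | cons a l ih => exact (ih _).trans (Step.newOwner_lift_of_notMem own' a hi)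

theorem Legal.map_lift {e : Fin m → Fin m'} (he : Function.Injective e) {own : Ownership m}
    {own' : Ownership m'} (ho : ∀ i, own' (e i) = own i) {l : List (Step n m)}
    (hl : Legal own l) : Legal own' (l.map (Step.lift e)) := by
  induction l generalizing own own' with
  | nil => trivial
  | cons a l ih =>
    refine ⟨?_, ih (Step.newOwner_lift he ho a) hl.2⟩
    cases a with
    | apply p U => exact fun z => (hl.1 z).lift he ho
    | send j => trivial

theorem foldl_act_map_lift {e : Fin m → Fin m'} (he : Function.Injective e) (x y : Bits n)
    (ψ : QState m) (χ : QState m') (hχ : ∀ v s, χ (Function.extend e v s) = χ s)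
    (l : List (Step n m)) :
    (l.map (Step.lift e)).foldl (Step.act x y) (fun s => ψ (s ∘ e) * χ s) =
      fun s => l.foldl (Step.act x y) ψ (s ∘ e) * χ s := by
  induction l generalizing ψ with
  | nil => rfl
  | cons a l ih =>
    refine Eq.trans ?_ (ih (Step.act x y ψ a))
    change List.foldl _ (Step.act x y _ (a.lift e)) _ = _
    congr 1
    cases a with
    | send i => rfl
    | apply p U => cases p <;> exact lift_mulVec_mul he _ ψ χ hχ

end LiftStep

/-! ### Disjunction of the outputs of two protocols -/

/-- There is a protocol with communication `c` that outputs `false` with probability `g x y`. -/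
def Computes {n : ℕ} (c : ℕ) (g : Bits n → Bits n → ℝ) : Prop :=
  ∃ P : Protocol n, P.communication = c ∧ ∀ x y, P.outputProb x y false = g x y

/-- Reversible computation of the disjunction of two bits into a third one. -/
def orGate (s : Fin 3 → Bool) : Fin 3 → Bool :=
  Function.update s 0 (xor (s 0) (s 1 || s 2))

theorem orGate_involutive : Function.Involutive orGate := by
  intro s
  funext i
  fin_cases i <;> simp [orGate]

/-- Running two protocols one after the other and outputting the disjunction of the outputs. -/
theorem Computes.mul {n : ℕ} {c₁ c₂ : ℕ} {g₁ g₂ : Bits n → Bits n → ℝ}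
    (h₁ : Computes c₁ g₁) (h₂ : Computes c₂ g₂) :
    Computes (c₁ + c₂) fun x y => g₁ x y * g₂ x y := by
  obtain ⟨P, rfl, hP⟩ := h₁
  obtain ⟨Q, rfl, hQ⟩ := h₂
  let e₁ : Fin P.m → Fin (P.m + Q.m + 1) := fun i => (Fin.castAdd Q.m i).castSucc
  let e₂ : Fin Q.m → Fin (P.m + Q.m + 1) := fun i => (Fin.natAdd P.m i).castSucc
  -- The two runs use disjoint registers, so nothing has to be reset between them; the last qubit,
  -- owned by Bob, receives the disjunction.
  let o : Fin (P.m + Q.m + 1) := Fin.last _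
  have he₁ : Function.Injective e₁ := fun i j h => by
    simpa [e₁] using h
  have he₂ : Function.Injective e₂ := fun i j h => by
    simpa [e₂] using h
  have h12 : ∀ i j, e₁ i ≠ e₂ j := fun i j h => by
    have := congrArg Fin.val h
    simp only [e₁, e₂, Fin.val_castSucc, Fin.val_castAdd, Fin.val_natAdd] at this
    omega
  have h1o : ∀ i, e₁ i ≠ o := fun i => (Fin.castSucc_lt_last _).ne
  have h2o : ∀ i, e₂ i ≠ o := fun i => (Fin.castSucc_lt_last _).ne
  let e₃ : Fin 3 → Fin (P.m + Q.m + 1) := ![o, e₁ P.out, e₂ Q.out]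
  have he₃ : Function.Injective e₃ := by
    intro i j h
    fin_cases i <;> fin_cases j <;>
      first
      | rfl
      | exact absurd h (h1o _)
      | exact absurd h (h2o _)
      | exact absurd h (h12 _ _)
      | exact absurd h.symm (h1o _)
      | exact absurd h.symm (h2o _)
      | exact absurd h.symm (h12 _ _)
  let own : Ownership (P.m + Q.m + 1) :=
    Fin.snoc (α := fun _ => Party) (Fin.append P.start Q.start) Party.bob
  have own₁ : ∀ i, own (e₁ i) = P.start i := fun i => by simp [own, e₁]
  have own₂ : ∀ i, own (e₂ i) = Q.start i := fun i =>
    (Fin.snoc_castSucc (α := fun _ => Party) _ _ _).trans (Fin.append_right _ _ _)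
  have ownO : own o = Party.bob := by simp [own, o]
  have n12 : ∀ j, e₂ j ∉ Set.range e₁ := fun j ⟨i, h⟩ => h12 i j h
  have n21 : ∀ j, e₁ j ∉ Set.range e₂ := fun j ⟨i, h⟩ => h12 j i h.symm
  have n1o : o ∉ Set.range e₁ := fun ⟨i, h⟩ => h1o i h
  have n2o : o ∉ Set.range e₂ := fun ⟨i, h⟩ => h2o i h
  let l₁ : List (Step n (P.m + Q.m + 1)) := P.steps.map (Step.lift e₁)
  let l₂ : List (Step n (P.m + Q.m + 1)) := Q.steps.map (Step.lift e₂)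
  let l₃ : List (Step n (P.m + Q.m + 1)) :=
    [.apply .bob fun _ => lift e₃ (basisPerm orGate)]
  have ownA₂ : ∀ i, finalOwner own l₁ (e₂ i) = Q.start i := fun i =>
    (finalOwner_map_lift_of_notMem own _ (n12 i)).trans (own₂ i)
  let ownB := finalOwner (finalOwner own l₁) l₂
  have ownB₁ : ∀ i, ownB (e₁ i) = finalOwner P.start P.steps i := fun i =>
    (finalOwner_map_lift_of_notMem _ _ (n21 i)).trans (finalOwner_map_lift he₁ own₁ _ i)
  have ownB₂ : ∀ i, ownB (e₂ i) = finalOwner Q.start Q.steps i := fun i =>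
    finalOwner_map_lift he₂ ownA₂ _ i
  have ownBo : ownB o = Party.bob :=
    (finalOwner_map_lift_of_notMem _ _ n2o).trans
      ((finalOwner_map_lift_of_notMem _ _ n1o).trans ownO)
  have ownB₃ : ∀ i, ownB (e₃ i) = Party.bob := by
    intro i
    fin_cases i
    · exact ownBo
    · exact (ownB₁ _).trans P.out_bob
    · exact (ownB₂ _).trans Q.out_bob
  have legal : Legal own (l₁ ++ l₂ ++ l₃) := by
    rw [legal_append, legal_append, finalOwner_append]
    refine ⟨⟨P.legal.map_lift he₁ own₁, Q.legal.map_lift he₂ ownA₂⟩, fun _ => ?_, trivial⟩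
    refine IsLocalUnitary.lift (own := fun _ => Party.bob) he₃ ownB₃ ?_
    exact isLocalUnitary_of_forall_eq (fun _ => rfl)
      (basisPerm_mem_unitaryGroup orGate_involutive)
  refine ⟨⟨_, own, l₁ ++ l₂ ++ l₃, legal, o, ?_⟩, ?_, ?_⟩
  · rw [finalOwner_append, finalOwner_append]
    exact ownBo
  · simp only [Protocol.communication, List.map_append, List.sum_append, l₁, l₂,
      sum_cost_map_lift]
    simp [l₃, Step.cost]
  · intro x y
    -- The factor |0⟩ on the output qubit. The joint state stays a product of three factors until
    -- the gate acts.
    let δ : QState (P.m + Q.m + 1) := fun s => if s o = false then 1 else 0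
    have hδ : ∀ {k : ℕ} {e : Fin k → Fin (P.m + Q.m + 1)}, o ∉ Set.range e → ∀ v s,
        δ (Function.extend e v s) = δ s := fun he v s => by
      simp only [δ, Function.extend_apply' _ _ _ he]
    have hc : ∀ {k k' : ℕ} {e : Fin k → Fin (P.m + Q.m + 1)} {e' : Fin k' → Fin (P.m + Q.m + 1)},
        (∀ j, e' j ∉ Set.range e) → ∀ (v : Fin k → Bool) (s : Fin (P.m + Q.m + 1) → Bool),
          Function.extend e v s ∘ e' = s ∘ e' :=
      fun he v s => funext fun j => Function.extend_apply' _ _ _ (he j)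
    have start_eq : zeroState (P.m + Q.m + 1) =
        fun s => zeroState P.m (s ∘ e₁) * (zeroState Q.m (s ∘ e₂) * δ s) := by
      funext s
      simp only [zeroState, δ, Pi.single_apply]
      by_cases h : s = fun _ => false
      · subst h
        simp [Function.comp_def]
      · rw [if_neg h]
        by_cases h1 : s ∘ e₁ = fun _ => false
        · by_cases h2 : s ∘ e₂ = fun _ => false
          · rw [if_neg (c := s o = false), mul_zero, mul_zero]
            intro h3
            refine h (funext fun i => ?_)
            induction i using Fin.lastCases with
            | last => exact h3
            | cast i =>
              induction i using Fin.addCases with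
              | left i => exact congrFun h1 i
              | right i => exact congrFun h2 i
          · rw [if_neg h2, zero_mul, mul_zero]
        · rw [if_neg h1, zero_mul]
    have state₁ : l₁.foldl (Step.act x y) (zeroState (P.m + Q.m + 1)) =
        fun s => P.finalState x y (s ∘ e₁) * (zeroState Q.m (s ∘ e₂) * δ s) := by
      rw [start_eq]
      refine foldl_act_map_lift he₁ x y _ _ (fun v s => ?_) _
      rw [hc n12, hδ n1o]
    have state₂ : (l₁ ++ l₂).foldl (Step.act x y) (zeroState (P.m + Q.m + 1)) =
        fun s => Q.finalState x y (s ∘ e₂) * (P.finalState x y (s ∘ e₁) * δ s) := by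
      rw [List.foldl_append, state₁]
      refine Eq.trans ?_ (foldl_act_map_lift he₂ x y _ _ (fun v s => ?_) _)
      · refine congrArg (fun φ => List.foldl _ φ _) (funext fun s => ?_)
        ring
      · rw [hc n21, hδ n2o]
    have gate : ∀ s : Fin (P.m + Q.m + 1) → Bool,
        Function.extend e₃ (orGate (s ∘ e₃)) s =
          Function.update s o (xor (s o) (s (e₁ P.out) || s (e₂ Q.out))) := by
      intro s
      funext i
      by_cases h : i ∈ Set.range e₃
      · obtain ⟨k, rfl⟩ := h
        rw [he₃.extend_apply]
        fin_cases k
        · exact (Function.update_self o _ s).symm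
        · exact (Function.update_of_ne (h1o _) _ s).symm
        · exact (Function.update_of_ne (h2o _) _ s).symm
      · rw [Function.extend_apply' _ _ _ h, Function.update_of_ne]
        rintro rfl
        exact h ⟨0, rfl⟩
    have state₃ : ∀ s, (l₁ ++ l₂ ++ l₃).foldl (Step.act x y) (zeroState (P.m + Q.m + 1)) s =
        Q.finalState x y (s ∘ e₂) * (P.finalState x y (s ∘ e₁) *
          if xor (s o) (s (e₁ P.out) || s (e₂ Q.out)) = false then 1 else 0) := by
      intro s
      rw [List.foldl_append, state₂]
      change (lift e₃ (basisPerm orGate)).mulVec _ s = _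
      rw [lift_mulVec_apply he₃]
      simp only [basisPerm, Matrix.of_apply, ite_mul, one_mul, zero_mul, Finset.sum_ite_eq,
        Finset.mem_univ, if_true, gate]
      have u1 : ∀ b, Function.update s o b ∘ e₁ = s ∘ e₁ := fun b =>
        funext fun i => Function.update_of_ne (h1o i) _ _
      have u2 : ∀ b, Function.update s o b ∘ e₂ = s ∘ e₂ := fun b =>
        funext fun i => Function.update_of_ne (h2o i) _ _
      simp only [u1, u2, δ, Function.update_self]
    simp only [← hP, ← hQ, Protocol.outputProb]
    rw [Finset.sum_mul_sum, ← Fintype.sum_prod_type']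
    -- Split off the output qubit: its value `true` contributes nothing to the event `false`, and
    -- the remaining sum over pairs of strings factors.
    rw [← (Fin.snocEquiv fun _ => Bool).sum_comp, Fintype.sum_prod_type, Fintype.sum_bool,
      Finset.sum_eq_zero (f := fun s => _), zero_add, ← (Fin.appendEquiv P.m Q.m).sum_comp]
    · refine Finset.sum_congr rfl fun st _ => ?_
      obtain ⟨s, t⟩ := st
      set u : Fin (P.m + Q.m + 1) → Bool := Fin.snocEquiv (fun _ => Bool)
        (false, Fin.appendEquiv P.m Q.m (s, t)) with hu
      have uo : u o = false := by simp [hu, o]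
      have u1 : u ∘ e₁ = s := by
        funext i
        simp [hu, e₁]
      have u2 : u ∘ e₂ = t := by
        funext i
        exact (Fin.snoc_castSucc (α := fun _ => Bool) _ _ _).trans (Fin.append_right _ _ _)
      have u1' : u (e₁ P.out) = s P.out := congrFun u1 _
      have u2' : u (e₂ Q.out) = t Q.out := congrFun u2 _
      rw [if_pos uo]
      change ‖(l₁ ++ l₂ ++ l₃).foldl (Step.act x y) (zeroState (P.m + Q.m + 1)) u‖ ^ 2 = _
      rw [state₃, u1, u2, uo, u1', u2']
      cases hs : s P.out <;> cases ht : t Q.out <;> simp [hs, ht, mul_pow, mul_comm]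
    · intro s _
      rw [if_neg]
      simp [o]

/-! ### Protocols made of round trips of one register -/

section RoundTrips

variable {n w : ℕ}

/-- All `w` qubits start and end with Bob, they are sent to Alice and back `k` times, and the
resulting state is `φ x y`. -/
def Reach (k : ℕ) (φ : Bits n → Bits n → (Fin w → Bool) → ℝ) : Prop :=
  ∃ l : List (Step n w), Legal (fun _ => Party.bob) l ∧
    finalOwner (fun _ => Party.bob) l = (fun _ => Party.bob) ∧
    (l.map Step.cost).sum = 2 * w * k ∧
    ∀ x y, l.foldl (Step.act x y) (zeroState w) = fun s => (φ x y s : ℂ)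

theorem legal_map_send (own : Ownership w) (l : List (Fin w)) :
    Legal own (l.map (Step.send (n := n))) := by
  induction l generalizing own with
  | nil => trivial
  | cons a l ih => exact ⟨trivial, ih _⟩

theorem finalOwner_map_send (own : Ownership w) {l : List (Fin w)} (hl : l.Nodup) (i : Fin w) :
    finalOwner own (l.map (Step.send (n := n))) i = if i ∈ l then (own i).other else own i := by
  induction l generalizing own with
  | nil => rfl
  | cons a l ih =>
    rw [List.nodup_cons] at hl
    refine (ih _ hl.2).trans ?_
    simp only [Step.newOwner, Function.update_apply, List.mem_cons]
    by_cases h : i = a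
    · subst h
      simp [hl.1]
    · simp [h]

theorem finalOwner_send_all (p : Party) :
    finalOwner (fun _ => p) ((List.finRange w).map (Step.send (n := n))) = fun _ => p.other := by
  funext i
  rw [finalOwner_map_send _ (List.nodup_finRange w), if_pos (List.mem_finRange i)]

theorem sum_cost_map_send (l : List (Fin w)) :
    ((l.map (Step.send (n := n))).map Step.cost).sum = l.length := by
  induction l with
  | nil => rfl
  | cons a l ih =>
    simp only [List.map_cons, List.sum_cons, ih, Step.cost, List.length_cons, add_comm]

theorem foldl_act_map_send (x y : Bits n) (ψ : QState w) (l : List (Fin w)) :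
    (l.map (Step.send (n := n))).foldl (Step.act x y) ψ = ψ := by
  induction l with
  | nil => rfl
  | cons a l ih => exact ih

theorem reach_zero : Reach (n := n) (w := w) 0 fun _ _ => Pi.single (fun _ => false) 1 := by
  refine ⟨[], trivial, rfl, rfl, fun x y => ?_⟩
  funext s
  simp only [zeroState, List.foldl_nil, Pi.single_apply]
  split_ifs <;> simp

theorem Reach.bob {k : ℕ} {φ φ' : Bits n → Bits n → (Fin w → Bool) → ℝ} (h : Reach k φ)
    (U : Bits n → Matrix (Fin w → Bool) (Fin w → Bool) ℂ)
    (hU : ∀ y, U y ∈ Matrix.unitaryGroup (Fin w → Bool) ℂ)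
    (hφ : ∀ x y, (U y).mulVec (fun s => (φ x y s : ℂ)) = fun s => (φ' x y s : ℂ)) :
    Reach k φ' := by
  obtain ⟨l, h1, h2, h3, h4⟩ := h
  refine ⟨l ++ [.apply .bob U], ?_, ?_, ?_, fun x y => ?_⟩
  · rw [legal_append, h2]
    exact ⟨h1, fun y => isLocalUnitary_of_forall_eq (fun _ => rfl) (hU y), trivial⟩
  · rw [finalOwner_append, h2]
    rfl
  · simp [h3, Step.cost]
  · rw [List.foldl_append, h4]
    exact hφ x y

theorem Reach.alice {k : ℕ} {φ φ' : Bits n → Bits n → (Fin w → Bool) → ℝ} (h : Reach k φ)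
    (U : Bits n → Matrix (Fin w → Bool) (Fin w → Bool) ℂ)
    (hU : ∀ x, U x ∈ Matrix.unitaryGroup (Fin w → Bool) ℂ)
    (hφ : ∀ x y, (U x).mulVec (fun s => (φ x y s : ℂ)) = fun s => (φ' x y s : ℂ)) :
    Reach (k + 1) φ' := by
  obtain ⟨l, h1, h2, h3, h4⟩ := h
  let S : List (Step n w) := (List.finRange w).map Step.send
  refine ⟨l ++ (S ++ ([.apply .alice U] ++ S)), ?_, ?_, ?_, fun x y => ?_⟩
  · rw [legal_append, h2, legal_append, finalOwner_send_all, legal_append]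
    exact ⟨h1, legal_map_send _ _, ⟨fun x => isLocalUnitary_of_forall_eq (fun _ => rfl) (hU x),
      trivial⟩, legal_map_send _ _⟩
  · rw [finalOwner_append, h2, finalOwner_append, finalOwner_send_all, finalOwner_append]
    exact finalOwner_send_all _
  · simp only [List.map_append, List.sum_append, h3, S, sum_cost_map_send, List.length_finRange,
      List.map_cons, List.map_nil, Step.cost, List.sum_cons, List.sum_nil]
    ring
  · rw [List.foldl_append, h4, List.foldl_append, List.foldl_append, foldl_act_map_send,
      foldl_act_map_send]
    exact hφ x y

theorem Reach.computes {k : ℕ} {φ : Bits n → Bits n → (Fin w → Bool) → ℝ} (h : Reach k φ)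
    (o : Fin w) :
    Computes (2 * w * k) fun x y => ∑ s, if s o = false then φ x y s ^ 2 else 0 := by
  obtain ⟨l, h1, h2, h3, h4⟩ := h
  refine ⟨⟨w, fun _ => .bob, l, h1, o, congrFun h2 o⟩, h3, fun x y => ?_⟩
  refine Finset.sum_congr rfl fun s _ => ?_
  have : Protocol.finalState ⟨w, fun _ => .bob, l, h1, o, congrFun h2 o⟩ x y s =
    (φ x y s : ℂ) := congrFun (h4 x y) s
  rw [this, Complex.norm_real, Real.norm_eq_abs, sq_abs]

end RoundTrips

/-! ### Reflections and diagonal unitaries -/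

section Operators

variable {β : Type*} [Fintype β] [DecidableEq β]

/-- The matrix `c h hᵀ - 1`. -/
def reflection (c : ℝ) (h : β → ℝ) : Matrix β β ℂ :=
  Matrix.of fun s t => ((c * h s * h t - if s = t then 1 else 0 : ℝ) : ℂ)

theorem reflection_mulVec (c : ℝ) (h φ : β → ℝ) :
    (reflection c h).mulVec (fun s => (φ s : ℂ)) =
      fun s => ((c * (∑ t, h t * φ t) * h s - φ s : ℝ) : ℂ) := by
  funext s
  simp only [reflection, Matrix.mulVec, dotProduct, Matrix.of_apply]
  rw [← Complex.ofReal_inj.2 (?_ : ∑ t, (c * h s * h t - if s = t then 1 else 0) * φ t = _)]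
  · push_cast
    rfl
  · simp only [sub_mul, Finset.sum_sub_distrib, ite_mul, one_mul, zero_mul, Finset.sum_ite_eq,
      Finset.mem_univ, if_true, Finset.mul_sum, Finset.sum_mul]
    congr 1
    exact Finset.sum_congr rfl fun t _ => by ring

/-- With c|h|² = 2 the matrix is a real symmetric involution, twice the projection onto `h` minus
the identity. -/
theorem reflection_mem_unitaryGroup {c : ℝ} {h : β → ℝ} (hc : c * ∑ s, h s ^ 2 = 2) :
    reflection c h ∈ Matrix.unitaryGroup β ℂ := by
  rw [Matrix.mem_unitaryGroup_iff]
  ext s t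
  have hs : star (reflection c h) = reflection c h := by
    ext s t
    simp only [reflection, Matrix.star_apply, Matrix.of_apply, Complex.star_def,
      Complex.conj_ofReal]
    congr 2
    · ring
    · exact if_congr eq_comm rfl rfl
  rw [hs]
  change (reflection c h).mulVec
    (fun u => ((c * h u * h t - if u = t then 1 else 0 : ℝ) : ℂ)) s = _
  rw [reflection_mulVec]
  have : ∑ u, h u * (c * h u * h t - if u = t then 1 else 0) = h t := by
    simp only [mul_sub, Finset.sum_sub_distrib, mul_ite, mul_one, mul_zero, Finset.sum_ite_eq',
      Finset.mem_univ, if_true]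
    have : ∑ u, h u * (c * h u * h t) = c * (∑ u, h u ^ 2) * h t := by
      rw [Finset.mul_sum, Finset.sum_mul]
      exact Finset.sum_congr rfl fun u _ => by ring
    rw [this, hc]
    ring
  rw [this, Matrix.one_apply]
  split_ifs with hst
  · beta_reduce
    rw [if_pos hst]
    push_cast
    ring
  · beta_reduce
    rw [if_neg hst]
    push_cast
    ring

theorem diagonal_mem_unitaryGroup {d : β → ℝ} (hd : ∀ s, d s * d s = 1) :
    Matrix.diagonal (fun s => (d s : ℂ)) ∈ Matrix.unitaryGroup β ℂ := by
  rw [Matrix.mem_unitaryGroup_iff, Matrix.star_eq_conjTranspose, Matrix.diagonal_conjTranspose,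
    Matrix.diagonal_mul_diagonal, ← Matrix.diagonal_one]
  refine congrArg _ (funext fun s => ?_)
  simp only [Pi.star_apply, Complex.star_def, Complex.conj_ofReal]
  exact_mod_cast hd s

end Operators

/-! ### Grover search as a protocol -/

section Search

variable {n w : ℕ}

/-- Reflecting about the bisector of |0…0⟩ and `v` maps the former to the latter. The sign condition
keeps the sum of the two vectors nonzero. -/
theorem reach_unit {v : (Fin w → Bool) → ℝ} (hv : ∑ s, v s ^ 2 = 1)
    (h0 : 0 ≤ v fun _ => false) : Reach (n := n) 0 fun _ _ => v := by
  have hpos : 0 < 1 + v fun _ => false := by linarith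
  refine reach_zero.bob
    (fun _ => reflection (1 / (1 + v fun _ => false)) (Pi.single (fun _ => false) 1 + v))
    (fun _ => reflection_mem_unitaryGroup ?_) (fun _ _ => ?_)
  · have : ∑ s, (Pi.single (fun _ => false) 1 + v : (Fin w → Bool) → ℝ) s ^ 2 = 2 * (1 + v fun _ => false) := by
      have : ∀ s, (Pi.single (fun _ => false) 1 + v : (Fin w → Bool) → ℝ) s ^ 2 =
          (if s = (fun _ => false) then 1 + 2 * v s else 0) + v s ^ 2 := by
        intro s
        simp only [Pi.add_apply, Pi.single_apply]
        split_ifs <;> ring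
      simp only [this, Finset.sum_add_distrib, hv, Finset.sum_ite_eq', Finset.mem_univ, if_true]
      ring
    rw [this]
    field_simp
  · rw [reflection_mulVec]
    funext s
    congr 1
    have : ∑ t, (Pi.single (fun _ => false) 1 + v : (Fin w → Bool) → ℝ) t *
        (Pi.single (fun _ => false) 1 : (Fin w → Bool) → ℝ) t = 1 + v fun _ => false := by
      simp [Pi.single_apply]
    rw [this, one_div, inv_mul_cancel₀ hpos.ne']
    simp

/-- The amplitudes, relative to the starting vector, of the marked and of the unmarked elements
after `j` Grover iterations, when the marked elements have weight `S`. -/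
def groverCoeff (S : ℝ) : ℕ → ℝ × ℝ
  | 0 => (1, 1)
  | j + 1 =>
    ((groverCoeff S j).1 * (1 - 2 * S) + 2 * (groverCoeff S j).2 * (1 - S),
      -2 * (groverCoeff S j).1 * S + (groverCoeff S j).2 * (1 - 2 * S))

/-- Each iteration rotates by 2α in the plane of the marked and unmarked parts. The products on the
left avoid dividing by sin α or cos α, which may vanish. -/
theorem groverCoeff_sin_sq (α : ℝ) (j : ℕ) :
    Real.sin α * (groverCoeff (Real.sin α ^ 2) j).1 = Real.sin ((2 * j + 1) * α) ∧
      Real.cos α * (groverCoeff (Real.sin α ^ 2) j).2 = Real.cos ((2 * j + 1) * α) := by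
  induction j with
  | zero => simp [groverCoeff]
  | succ j ih =>
    have e : (2 * ((j + 1 : ℕ) : ℝ) + 1) * α = (2 * j + 1) * α + 2 * α := by
      push_cast
      ring
    rw [e, Real.sin_add, Real.cos_add, ← ih.1, ← ih.2, Real.sin_two_mul, Real.cos_two_mul]
    have hc : Real.cos α ^ 2 = 1 - Real.sin α ^ 2 := by
      rw [← Real.sin_sq_add_cos_sq α]
      ring
    simp only [groverCoeff]
    rw [← hc, hc]
    constructor
    · linear_combination (-2 * Real.sin α * (groverCoeff (Real.sin α ^ 2) j).2) * hc
    · ring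

variable {b f : Fin w} {X Y : Bits n → (Fin w → Bool) → Bool} {v : (Fin w → Bool) → ℝ}

/-- The unitary that adds the bit `g` to the qubit `b`. -/
def xorAt (b : Fin w) (g : (Fin w → Bool) → Bool) (s : Fin w → Bool) : Fin w → Bool :=
  Function.update s b (xor (s b) (g s))

theorem xorAt_involutive {g : (Fin w → Bool) → Bool}
    (hg : ∀ s c, g (Function.update s b c) = g s) : Function.Involutive (xorAt b g) := by
  intro s
  funext i
  by_cases h : i = b
  · subst h
    simp [xorAt, hg]
  · simp [xorAt, hg, h]

/-- Phase query in one round trip: Bob adds `Y` to the clean qubit `b`, Alice flips the sign where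
`X` and `b` hold, Bob uncomputes `b`. -/
theorem Reach.query {k : ℕ} {φ : Bits n → Bits n → (Fin w → Bool) → ℝ} (h : Reach k φ)
    (hφ : ∀ x y s, s b = true → φ x y s = 0)
    (hX : ∀ x s c, X x (Function.update s b c) = X x s)
    (hY : ∀ y s c, Y y (Function.update s b c) = Y y s) :
    Reach (k + 1) fun x y s => if X x s && Y y s then -φ x y s else φ x y s := by
  have hσ : ∀ y, Function.Involutive (xorAt b (Y y)) := fun y => xorAt_involutive (hY y)
  have h1 : Reach k fun x y s => φ x y (xorAt b (Y y) s) :=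
    h.bob (fun y => basisPerm (xorAt b (Y y))) (fun y => basisPerm_mem_unitaryGroup (hσ y))
      fun x y => basisPerm_mulVec _ _
  have h2 : Reach (k + 1) fun x y s =>
      (if X x s && s b then (-1 : ℝ) else 1) * φ x y (xorAt b (Y y) s) := by
    refine h1.alice (fun x => Matrix.diagonal fun s =>
      ((if X x s && s b then (-1 : ℝ) else 1 : ℝ) : ℂ))
      (fun x => diagonal_mem_unitaryGroup fun s => ?_) fun x y => ?_
    · split_ifs <;> norm_num
    · funext s
      rw [Matrix.mulVec_diagonal, Complex.ofReal_mul]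
  refine h2.bob (fun y => basisPerm (xorAt b (Y y)))
    (fun y => basisPerm_mem_unitaryGroup (hσ y)) fun x y => ?_
  rw [basisPerm_mulVec]
  funext s
  congr 1
  rw [hσ y s]
  by_cases hs : s b = true
  · simp [hφ x y s hs]
  · have hs' : s b = false := by simpa using hs
    have : (X x (xorAt b (Y y) s) && xorAt b (Y y) s b) = (X x s && Y y s) := by
      simp [xorAt, hX, hs']
    rw [this]
    split_ifs <;> ring

/-- Final verification: Alice writes the conjunction of `X` and Bob's bit `b` into the clean flag
`f`, and `f` is measured. The value `false` has the total weight of the unmarked strings. -/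
theorem Reach.check {k : ℕ} {φ : Bits n → Bits n → (Fin w → Bool) → ℝ} (h : Reach k φ)
    (hbf : b ≠ f) (hφb : ∀ x y s, s b = true → φ x y s = 0)
    (hφf : ∀ x y s, s f = true → φ x y s = 0)
    (hX : ∀ x s c, X x (Function.update s b c) = X x s)
    (hXf : ∀ x s c, X x (Function.update s f c) = X x s)
    (hY : ∀ y s c, Y y (Function.update s b c) = Y y s) :
    Computes (2 * w * (k + 1)) fun x y =>
      ∑ s, if X x s && Y y s then 0 else φ x y s ^ 2 := by
  have hσ : ∀ y, Function.Involutive (xorAt b (Y y)) := fun y => xorAt_involutive (hY y)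
  have hτ : ∀ x, Function.Involutive (xorAt f fun s => X x s && s b) := fun x =>
    xorAt_involutive fun s c => by rw [hXf, Function.update_of_ne hbf]
  have h1 : Reach k fun x y s => φ x y (xorAt b (Y y) s) :=
    h.bob (fun y => basisPerm (xorAt b (Y y))) (fun y => basisPerm_mem_unitaryGroup (hσ y))
      fun x y => basisPerm_mulVec _ _
  have h2 : Reach (k + 1) fun x y s =>
      φ x y (xorAt b (Y y) (xorAt f (fun s => X x s && s b) s)) :=
    h1.alice (fun x => basisPerm (xorAt f fun s => X x s && s b))
      (fun x => basisPerm_mem_unitaryGroup (hτ x)) fun x y => basisPerm_mulVec _ _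
  convert h2.computes f using 3 with x y
  -- Reindex the measured sum by the basis permutation that was performed, so that the amplitude
  -- appears at its original string.
  refine Eq.trans ?_ (((hσ y).toPerm.trans (hτ x).toPerm).sum_comp fun s =>
    if s f = false then φ x y (xorAt b (Y y) (xorAt f (fun s => X x s && s b) s)) ^ 2 else 0)
  refine Finset.sum_congr rfl fun s _ => ?_
  change _ = if xorAt f (fun s => X x s && s b) (xorAt b (Y y) s) f = false then
    φ x y (xorAt b (Y y) (xorAt f (fun s => X x s && s b)
      (xorAt f (fun s => X x s && s b) (xorAt b (Y y) s)))) ^ 2 else 0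
  rw [hτ x, hσ y]
  by_cases hb : s b = true
  · simp [hφb x y s hb]
  by_cases hf : s f = true
  · simp [hφf x y s hf]
  have hb' : s b = false := by simpa using hb
  have hf' : s f = false := by simpa using hf
  have : xorAt f (fun s => X x s && s b) (xorAt b (Y y) s) f = (X x s && Y y s) := by
    simp [xorAt, hX, hb', hf', Function.update_of_ne hbf.symm]
  rw [this]
  cases X x s && Y y s <;> simp

/-- Grover search for the elements marked by `X x` and `Y y`, from the starting vector `v`. -/
theorem computes_grover (hbf : b ≠ f) (hv : ∑ s, v s ^ 2 = 1) (h0 : 0 ≤ v fun _ => false)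
    (hvb : ∀ s, s b = true → v s = 0) (hvf : ∀ s, s f = true → v s = 0)
    (hX : ∀ x s c, X x (Function.update s b c) = X x s)
    (hXf : ∀ x s c, X x (Function.update s f c) = X x s)
    (hY : ∀ y s c, Y y (Function.update s b c) = Y y s) (α : Bits n → Bits n → ℝ)
    (hα : ∀ x y, ∑ s, (if X x s && Y y s then v s ^ 2 else 0) = Real.sin (α x y) ^ 2) (j : ℕ) :
    Computes (2 * w * (j + 1)) fun x y => Real.cos ((2 * j + 1) * α x y) ^ 2 := by
  let c : Bits n → Bits n → ℕ → ℝ × ℝ := fun x y j => groverCoeff (Real.sin (α x y) ^ 2) j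
  have hcompl : ∀ x y, ∑ s, (if X x s && Y y s then 0 else v s ^ 2) =
      1 - Real.sin (α x y) ^ 2 := by
    intro x y
    rw [← hα, ← hv, ← Finset.sum_sub_distrib]
    refine Finset.sum_congr rfl fun s _ => ?_
    split_ifs <;> ring
  have hreach : ∀ j, Reach j fun x y s =>
      v s * if X x s && Y y s then (c x y j).1 else (c x y j).2 := by
    intro j
    induction j with
    | zero =>
      convert reach_unit (n := n) hv h0 using 4 with x y s
      simp [c, groverCoeff]
    | succ j ih =>
      refine (ih.query (b := b) (X := X) (Y := Y) ?_ hX hY).bob (fun _ => reflection 2 v)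
        (fun _ => reflection_mem_unitaryGroup (by rw [hv, mul_one])) fun x y => ?_
      · intro x y s hs
        rw [hvb s hs, zero_mul]
      · rw [reflection_mulVec]
        -- Inner product of `v` with the state after the query; inserted in the reflection about `v`
        -- it gives the recursion of `groverCoeff`.
        have hsum : ∑ t, v t * (if X x t && Y y t then
            -(v t * if X x t && Y y t then (c x y j).1 else (c x y j).2) else
            v t * if X x t && Y y t then (c x y j).1 else (c x y j).2) =
            -(c x y j).1 * Real.sin (α x y) ^ 2 +
              (c x y j).2 * (1 - Real.sin (α x y) ^ 2) := by
          rw [← hcompl, ← hα, Finset.mul_sum, Finset.mul_sum, ← Finset.sum_add_distrib]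
          refine Finset.sum_congr rfl fun s _ => ?_
          split_ifs <;> ring
        funext s
        congr 1
        rw [hsum]
        simp only [c, groverCoeff]
        split_ifs <;> ring
  convert (hreach j).check (b := b) (f := f) (X := X) (Y := Y) hbf ?_ ?_ hX hXf hY using 3 with x y
  · rw [← (groverCoeff_sin_sq _ _).2, mul_pow, Real.cos_sq', ← hcompl, Finset.sum_mul]
    refine Finset.sum_congr rfl fun s _ => ?_
    split_ifs
    · ring
    · simp only [c]
      ring
  · intro x y s hs
    rw [hvb s hs, zero_mul]
  · intro x y s hs
    rw [hvf s hs, zero_mul]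

end Search

/-! ### The search register and the number of marked addresses -/

section Counting

variable {n q : ℕ}

theorem sum_bits_three (F : (Fin (q + 3) → Bool) → ℝ) :
    ∑ s, F s = ∑ r : Bool, ∑ b : Bool, ∑ f : Bool, ∑ z : Fin q → Bool,
      F (Fin.cons (α := fun _ => Bool) r (Fin.cons (α := fun _ => Bool) b
        (Fin.cons (α := fun _ => Bool) f z))) := by
  rw [← (Fin.consEquiv fun _ => Bool).sum_comp, Fintype.sum_prod_type]
  refine Finset.sum_congr rfl fun r _ => ?_
  rw [← (Fin.consEquiv fun _ => Bool).sum_comp, Fintype.sum_prod_type]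
  refine Finset.sum_congr rfl fun b _ => ?_
  rw [← (Fin.consEquiv fun _ => Bool).sum_comp, Fintype.sum_prod_type]
  rfl

/-- The bit of `x` at the address `z`, where position `i` has address `e i`; unused addresses
hold `false`. -/
def lookup (e : Fin n → Fin q → Bool) (x : Bits n) (z : Fin q → Bool) : Bool :=
  decide (∃ i, e i = z ∧ x i = true)

/-- The number of addresses at which both inputs hold `true`. -/
def commonCount (e : Fin n → Fin q → Bool) (x y : Bits n) : ℕ :=
  (Finset.univ.filter fun z => (lookup e x z && lookup e y z) = true).card

theorem commonCount_le (e : Fin n → Fin q → Bool) (x y : Bits n) : commonCount e x y ≤ 2 ^ q := by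
  refine (Finset.card_filter_le _ _).trans ?_
  simp

theorem commonCount_eq_zero_iff {e : Fin n → Fin q → Bool} (he : Function.Injective e)
    (x y : Bits n) : commonCount e x y = 0 ↔ IN x y = false := by
  rw [commonCount, Finset.card_eq_zero, Finset.filter_eq_empty_iff, IN, decide_eq_false_iff_not]
  simp only [lookup, Bool.and_eq_true, decide_eq_true_eq]
  constructor
  · rintro h ⟨i, hx, hy⟩
    exact h (Finset.mem_univ (e i)) ⟨⟨i, rfl, hx⟩, ⟨i, rfl, hy⟩⟩
  · rintro h z _ ⟨⟨i, rfl, hx⟩, ⟨k, hk, hy⟩⟩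
    exact h ⟨i, hx, he hk ▸ hy⟩

/-- Uniform over the addresses, the first qubit having amplitude `a` at `true`. -/
noncomputable def searchVec (q : ℕ) (a : ℝ) (s : Fin (q + 3) → Bool) : ℝ :=
  if s 1 || s 2 then 0 else (if s 0 then a else √(1 - a ^ 2)) / √(2 ^ q)

theorem computes_search (e : Fin n → Fin q → Bool) {a : ℝ} (ha0 : 0 ≤ a) (ha1 : a ≤ 1) (j : ℕ) :
    Computes (2 * (q + 3) * (j + 1)) fun x y =>
      Real.cos ((2 * j + 1) * Real.arcsin (a * √(commonCount e x y / 2 ^ q))) ^ 2 := by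
  have hN : (0 : ℝ) < 2 ^ q := by positivity
  have ha : 0 ≤ 1 - a ^ 2 := by nlinarith
  -- Qubit 0 is the biased qubit, 1 the work qubit, 2 the flag; the rest is the address. Including
  -- qubit 0 in Bob's mark makes the marked weight a² t / 2^q.
  refine computes_grover (w := q + 3) (b := 1) (f := 2) (v := searchVec q a)
    (X := fun x s => lookup e x fun i => s i.succ.succ.succ)
    (Y := fun y s => lookup e y (fun i => s i.succ.succ.succ) && s 0)
    (by simp [Fin.ext_iff, Nat.mod_eq_of_lt (show 2 < q + 3 by omega)]) ?_ ?_ ?_ ?_ ?_ ?_ ?_ _ ?_ j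
  · rw [sum_bits_three]
    have h1 : ∀ r b f : Bool, ∀ z : Fin q → Bool,
        searchVec q a (Fin.cons (α := fun _ => Bool) r (Fin.cons (α := fun _ => Bool) b
          (Fin.cons (α := fun _ => Bool) f z))) ^ 2 =
        if b || f then 0 else (if r then a ^ 2 else 1 - a ^ 2) / 2 ^ q := by
      intro r b f z
      change (if b || f then 0 else (if r then a else √(1 - a ^ 2)) / √(2 ^ q) : ℝ) ^ 2 = _
      cases b <;> cases f <;> cases r <;> simp [div_pow, Real.sq_sqrt ha]
    simp only [h1, Fintype.sum_bool]
    simp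
    field_simp
    ring
  · simp only [searchVec]
    simp only [Bool.or_self, Bool.false_eq_true, if_false]
    positivity
  · intro s hs
    simp [searchVec, hs]
  · intro s hs
    simp [searchVec, hs]
  · intro x s c
    congr 1
  · intro x s c
    congr 1
  · intro y s c
    congr 1
  · intro x y
    have ht : (commonCount e x y : ℝ) ≤ 2 ^ q := by exact_mod_cast commonCount_le e x y
    have hx : a * √(commonCount e x y / 2 ^ q) ≤ 1 := by
      refine mul_le_one₀ ha1 (Real.sqrt_nonneg _) (Real.sqrt_le_one.2 ?_)
      exact (div_le_one hN).2 ht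
    have hx0 : 0 ≤ a * √(commonCount e x y / 2 ^ q) := by positivity
    rw [Real.sin_arcsin (by linarith) hx, mul_pow, Real.sq_sqrt (by positivity), sum_bits_three]
    have h1 : ∀ r b f : Bool, ∀ z : Fin q → Bool,
        (if (lookup e x z && (lookup e y z && r)) = true then
          searchVec q a (Fin.cons (α := fun _ => Bool) r (Fin.cons (α := fun _ => Bool) b
          (Fin.cons (α := fun _ => Bool) f z))) ^ 2 else 0) =
        if (lookup e x z && lookup e y z) = true then
          (if b || f || !r then 0 else a ^ 2 / 2 ^ q) else 0 := by
      intro r b f z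
      change (if (lookup e x z && (lookup e y z && r)) = true then
        (if b || f then 0 else (if r then a else √(1 - a ^ 2)) / √(2 ^ q) : ℝ) ^ 2 else 0) = _
      cases lookup e x z <;> cases lookup e y z <;> cases b <;> cases f <;> cases r <;>
        simp [div_pow]
    refine Eq.trans (Finset.sum_congr rfl fun r _ => Finset.sum_congr rfl fun b _ =>
      Finset.sum_congr rfl fun f _ => Finset.sum_congr rfl fun z _ => h1 r b f z) ?_
    simp only [Fintype.sum_bool, ← Finset.sum_filter, Finset.sum_const]
    simp [commonCount]
    ring

end Counting

/-! ### Tuning one search to a guessed number of marked addresses -/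

/-- A search that certainly succeeds if there are exactly `s` marked addresses, and succeeds with
a constant probability if there are between `s / 4` and `s`. -/
theorem exists_search {n q : ℕ} (e : Fin n → Fin q → Bool) {s : ℝ} (hs0 : 0 < s)
    (hs : s ≤ 2 ^ q) :
    ∃ (c : ℕ) (g : ℕ → ℝ), Computes c (fun x y => g (commonCount e x y)) ∧
      (c : ℝ) ≤ 6 * (q + 3) * √(2 ^ q / s) ∧ g 0 = 1 ∧ (∀ t, 0 ≤ g t ∧ g t ≤ 1) ∧
      (∀ t : ℕ, (t : ℝ) = s → g t = 0) ∧ ∀ t : ℕ, (t : ℝ) ≤ s → s ≤ 4 * t → g t ≤ 9 / 10 := by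
  have hN : (0 : ℝ) < 2 ^ q := by positivity
  set κ : ℝ := √(s / 2 ^ q) with hκ
  have hκ0 : 0 < κ := Real.sqrt_pos.2 (by positivity)
  have hκ1 : κ ≤ 1 := Real.sqrt_le_one.2 ((div_le_one hN).2 hs)
  have hπ := Real.pi_pos
  set j : ℕ := ⌈Real.pi / 4 / κ⌉₊ with hj
  have hj1 : Real.pi / 4 / κ ≤ j := Nat.le_ceil _
  have hj2 : (j : ℝ) < Real.pi / 4 / κ + 1 := Nat.ceil_lt_add_one (by positivity)
  set M : ℝ := 2 * j + 1 with hM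
  have hM1 : 1 ≤ M := by
    have : (0 : ℝ) ≤ j := j.cast_nonneg
    linarith
  have hM0 : 0 < M := by linarith
  set η : ℝ := Real.pi / 2 / M with hη
  have hη0 : 0 < η := by positivity
  have hη1 : η ≤ Real.pi / 2 := div_le_self (by positivity) hM1
  have hMη : M * η = Real.pi / 2 := by
    rw [hη]
    field_simp
  have hηκ : η ≤ κ := by
    rw [hη, div_le_iff₀ hM0]
    rw [div_le_iff₀ hκ0] at hj1
    rw [hM]
    nlinarith
  have hsin0 : 0 ≤ Real.sin η := Real.sin_nonneg_of_nonneg_of_le_pi hη0.le (by linarith)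
  have hsin : Real.sin η ≤ κ := (Real.sin_le hη0.le).trans hηκ
  have harg : ∀ t : ℕ, Real.sin η / κ * √(t / 2 ^ q) = Real.sin η * √(t / s) := by
    intro t
    have : (t : ℝ) / 2 ^ q = t / s * (s / 2 ^ q) := by field_simp
    rw [this, Real.sqrt_mul (by positivity), ← hκ]
    field_simp
  refine ⟨_, fun t => Real.cos (M * Real.arcsin (Real.sin η / κ * √(t / 2 ^ q))) ^ 2,
    computes_search e (div_nonneg hsin0 hκ0.le) ((div_le_one hκ0).2 hsin) j, ?_, ?_, ?_, ?_, ?_⟩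
  · have h1 : √(2 ^ q / s) = 1 / κ := by
      rw [hκ, one_div, ← Real.sqrt_inv, inv_div]
    have h2 : (j : ℝ) + 1 ≤ 3 * (1 / κ) := by
      have h3 : 1 ≤ 1 / κ := (one_le_div hκ0).2 hκ1
      have h4 : Real.pi / 4 / κ ≤ 1 * (1 / κ) := by
        rw [one_mul]
        gcongr
        linarith [Real.pi_le_four]
      linarith
    rw [h1]
    push_cast
    calc (2 * ((q : ℝ) + 3) * (j + 1)) ≤ 2 * ((q : ℝ) + 3) * (3 * (1 / κ)) := by gcongr
      _ = _ := by ring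
  · simp
  · exact fun t => ⟨sq_nonneg _, Real.cos_sq_le_one _⟩
  · intro t ht
    beta_reduce
    rw [harg, ht, div_self hs0.ne', Real.sqrt_one, mul_one,
      Real.arcsin_sin (by linarith) hη1, hMη, Real.cos_pi_div_two]
    norm_num
  · intro t ht1 ht2
    beta_reduce
    rw [harg]
    have hρ1 : √(t / s) ≤ 1 := Real.sqrt_le_one.2 ((div_le_one hs0).2 ht1)
    have hρ2 : 1 / 2 ≤ √(t / s) := by
      refine Real.le_sqrt_of_sq_le ?_
      rw [le_div_iff₀ hs0]
      linarith
    set ξ : ℝ := Real.sin η * √(t / s) with hξ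
    have hξ1 : ξ ≤ Real.sin η := mul_le_of_le_one_right hsin0 hρ1
    -- Jordan's inequality gives sin η ≥ 1/M, and t ≥ s/4 costs a factor of at most 2. Hence Mα lies
    -- in [1/2, π/2], and Jordan again gives sin(Mα) ≥ 1/π, with 1/π² ≥ 1/10.
    have hξ2 : 1 / (2 * M) ≤ ξ := by
      have h1 : 2 / Real.pi * η ≤ Real.sin η := Real.mul_le_sin hη0.le hη1
      have h2 : 2 / Real.pi * η = 1 / M := by
        rw [hη]
        field_simp
      rw [h2] at h1
      calc 1 / (2 * M) = 1 / M * (1 / 2) := by field_simp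
        _ ≤ ξ := mul_le_mul h1 hρ2 (by norm_num) hsin0
    have hξ0 : 0 ≤ ξ := le_trans (by positivity) hξ2
    set α : ℝ := Real.arcsin ξ with hα
    have hα0 : 0 ≤ α := Real.arcsin_nonneg.2 hξ0
    have hαη : α ≤ η := by
      rw [← Real.arcsin_sin (by linarith : -(Real.pi / 2) ≤ η) hη1]
      exact Real.monotone_arcsin hξ1
    have hξα : ξ ≤ α := by
      have := Real.sin_le hα0
      rwa [hα, Real.sin_arcsin (by linarith) (hξ1.trans (Real.sin_le_one η))] at this
    have hMα1 : 1 / 2 ≤ M * α := by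
      calc 1 / 2 = M * (1 / (2 * M)) := by field_simp
        _ ≤ M * α := mul_le_mul_of_nonneg_left (hξ2.trans hξα) hM0.le
    have hMα2 : M * α ≤ Real.pi / 2 := hMη ▸ mul_le_mul_of_nonneg_left hαη hM0.le
    have h3 : 2 / Real.pi * (M * α) ≤ Real.sin (M * α) :=
      Real.mul_le_sin (by positivity) hMα2
    have h4 : 1 / Real.pi ≤ Real.sin (M * α) := by
      refine le_trans ?_ h3
      calc 1 / Real.pi = 2 / Real.pi * (1 / 2) := by ring
        _ ≤ _ := by gcongr
    have h5 : 1 / 10 ≤ (1 / Real.pi) ^ 2 := by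
      rw [one_div_pow]
      refine one_div_le_one_div_of_le (by positivity) ?_
      have := Real.pi_lt_d2
      nlinarith
    have h6 : (1 / Real.pi) ^ 2 ≤ Real.sin (M * α) ^ 2 := by gcongr
    rw [Real.cos_sq']
    linarith

/-! ### Products of protocols and the combined search -/

theorem computes_const {n : ℕ} {p : ℝ} (h0 : 0 ≤ p) (h1 : p ≤ 1) :
    Computes (n := n) 0 fun _ _ => p := by
  let v : (Fin 1 → Bool) → ℝ := fun s => if s 0 then √(1 - p) else √p
  have h2 : 0 ≤ 1 - p := by linarith
  have hv : ∑ s, v s ^ 2 = 1 := by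
    rw [← (Equiv.funUnique (Fin 1) Bool).symm.sum_comp, Fintype.sum_bool]
    simp [v, Real.sq_sqrt, h0, h2]
  convert (reach_unit (n := n) hv (by simp [v])).computes 0 using 3
  rw [← (Equiv.funUnique (Fin 1) Bool).symm.sum_comp, Fintype.sum_bool]
  simp [v, Real.sq_sqrt, h0]

theorem Computes.prod {n : ℕ} {ι : Type*} (S : Finset ι) {c : ι → ℕ}
    {g : ι → Bits n → Bits n → ℝ} (h : ∀ i, Computes (c i) (g i)) :
    Computes (∑ i ∈ S, c i) fun x y => ∏ i ∈ S, g i x y := by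
  classical
  induction S using Finset.induction_on with
  | empty => simpa using computes_const (n := n) zero_le_one le_rfl
  | insert i S hi ih =>
    simp only [Finset.sum_insert hi, Finset.prod_insert hi]
    exact (h i).mul ih

theorem Computes.pow {n c : ℕ} {g : Bits n → Bits n → ℝ} (h : Computes c g) (k : ℕ) :
    Computes (k * c) fun x y => g x y ^ k := by
  simpa using Computes.prod (Finset.range k) fun _ => h

/-- Telescoping: 1/√(m+1) ≤ 2(√(m+1) - √m). -/
theorem sum_one_div_sqrt_le (m : ℕ) : ∑ i ∈ Finset.Icc 1 m, 1 / √(i : ℝ) ≤ 2 * √m := by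
  induction m with
  | zero => simp
  | succ m ih =>
    rw [Finset.sum_Icc_succ_top (by omega)]
    refine (add_le_add_left ih _).trans ?_
    push_cast
    have h0 : (0 : ℝ) ≤ m := m.cast_nonneg
    have h1 : 0 < √((m : ℝ) + 1) := Real.sqrt_pos.2 (by linarith)
    have h2 := Real.sq_sqrt (by linarith : 0 ≤ (m : ℝ) + 1)
    have h3 := Real.sq_sqrt h0
    rw [← le_sub_iff_add_le', div_le_iff₀ h1]
    nlinarith [sq_nonneg (√((m : ℝ) + 1) - √m)]

theorem sum_one_div_two_pow_le {u r : ℕ} (h : u ≤ r) :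
    ∑ k ∈ Finset.Ioc u r, (1 / 2 ^ k : ℝ) ≤ 1 / 2 ^ u - 1 / 2 ^ r := by
  induction r, h using Nat.le_induction with
  | base => simp
  | succ r h ih =>
    rw [Finset.sum_Ioc_succ_top h]
    have : (1 / 2 ^ r : ℝ) = 2 * (1 / 2 ^ (r + 1)) := by
      rw [pow_succ]
      field_simp
    linarith

/-- One search for each possible number of marked addresses up to `4 ^ u`, and `10 * 4 ^ u`
searches for each larger power of four up to `4 ^ r`. -/
theorem exists_combined_search {n r u : ℕ} (hu : u ≤ r) (e : Fin n → Fin (2 * r) → Bool) :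
    ∃ (c : ℕ) (g : ℕ → ℝ), Computes c (fun x y => g (commonCount e x y)) ∧
      (c : ℝ) ≤ 72 * (2 * r + 3) * (2 ^ r * 2 ^ u) ∧ g 0 = 1 ∧
      (∀ t, 1 ≤ t → t ≤ 4 ^ u → g t = 0) ∧
      ∀ t, 4 ^ u < t → t ≤ 4 ^ r → g t ≤ Real.exp (-4 ^ u) := by
  have hpow : (2 : ℝ) ^ (2 * r) = 4 ^ r := by
    rw [pow_mul]
    norm_num
  have H : ∀ i : ℕ, ∃ (c : ℕ) (g : ℕ → ℝ), Computes c (fun x y => g (commonCount e x y)) ∧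
      (c : ℝ) ≤ 6 * (2 * r + 3) * (2 ^ r * (1 / √i)) ∧ g 0 = 1 ∧ (∀ t, 0 ≤ g t ∧ g t ≤ 1) ∧
      (1 ≤ i → i ≤ 4 ^ r → g i = 0 ∧ ∀ t : ℕ, t ≤ i → i ≤ 4 * t → g t ≤ 9 / 10) := by
    intro i
    by_cases hi : 1 ≤ i ∧ i ≤ 4 ^ r
    · have hi0 : (0 : ℝ) < i := by exact_mod_cast hi.1
      have hi1 : (i : ℝ) ≤ 2 ^ (2 * r) := by
        rw [hpow]
        exact_mod_cast hi.2
      obtain ⟨c, g, h1, h2, h3, h4, h5, h6⟩ := exists_search e hi0 hi1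
      refine ⟨c, g, h1, ?_, h3, h4, fun _ _ => ⟨h5 i rfl, fun t ht1 ht2 =>
        h6 t (by exact_mod_cast ht1) (by exact_mod_cast ht2)⟩⟩
      rw [hpow, Real.sqrt_div (by positivity)] at h2
      have : √((4 : ℝ) ^ r) = 2 ^ r := by
        rw [show (4 : ℝ) ^ r = (2 ^ r) ^ 2 by rw [← pow_mul, mul_comm, pow_mul]; norm_num]
        exact Real.sqrt_sq (by positivity)
      rw [this] at h2
      push_cast at h2
      rw [mul_one_div]
      exact h2
    -- Guesses out of range get the free protocol that always outputs `false`, neutral for the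
    -- disjunction, so that the family is total.
    · refine ⟨0, fun _ => 1, computes_const zero_le_one le_rfl, ?_, rfl,
        fun _ => ⟨zero_le_one, le_rfl⟩, fun h1 h2 => absurd ⟨h1, h2⟩ hi⟩
      push_cast
      positivity
  choose c g h1 h2 h3 h4 h5 using H
  have hA := Computes.prod (Finset.Icc 1 (4 ^ u)) h1
  -- Ten repetitions per unit of exponent suffice, as 9/10 ≤ e^(-1/10).
  have hB := Computes.prod (Finset.Ioc u r) fun k => (h1 (4 ^ k)).pow (10 * 4 ^ u)
  refine ⟨_, fun t => (∏ i ∈ Finset.Icc 1 (4 ^ u), g i t) *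
    ∏ k ∈ Finset.Ioc u r, g (4 ^ k) t ^ (10 * 4 ^ u), hA.mul hB, ?_, ?_, ?_, ?_⟩
  · set B : ℝ := 6 * (2 * r + 3) * 2 ^ r with hBdef
    have hB0 : 0 ≤ B := by positivity
    have hs4 : ∀ k : ℕ, √((4 : ℝ) ^ k) = 2 ^ k := fun k => by
      rw [show (4 : ℝ) ^ k = (2 ^ k) ^ 2 by rw [← pow_mul, mul_comm, pow_mul]; norm_num]
      exact Real.sqrt_sq (by positivity)
    have b1 : ∑ i ∈ Finset.Icc 1 (4 ^ u), (c i : ℝ) ≤ B * (2 * 2 ^ u) := by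
      calc ∑ i ∈ Finset.Icc (1 : ℕ) (4 ^ u), (c i : ℝ)
          ≤ ∑ i ∈ Finset.Icc (1 : ℕ) (4 ^ u), B * (1 / √(i : ℝ)) :=
            Finset.sum_le_sum fun i _ => (h2 i).trans_eq (by rw [hBdef]; ring)
        _ = B * ∑ i ∈ Finset.Icc (1 : ℕ) (4 ^ u), 1 / √(i : ℝ) := by rw [Finset.mul_sum]
        _ ≤ B * (2 * 2 ^ u) := by
            refine mul_le_mul_of_nonneg_left ?_ hB0
            have := sum_one_div_sqrt_le (4 ^ u)
            push_cast at this
            rwa [hs4] at this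
    have b2 : ∑ k ∈ Finset.Ioc u r, (10 * 4 ^ u * c (4 ^ k) : ℝ) ≤ B * (10 * 2 ^ u) := by
      calc ∑ k ∈ Finset.Ioc u r, (10 * 4 ^ u * c (4 ^ k) : ℝ)
          ≤ ∑ k ∈ Finset.Ioc u r, B * (10 * 4 ^ u) * (1 / 2 ^ k) := by
            refine Finset.sum_le_sum fun k _ => ?_
            have := h2 (4 ^ k)
            push_cast at this
            rw [hs4] at this
            calc (10 * 4 ^ u * c (4 ^ k) : ℝ)
                ≤ 10 * 4 ^ u * (6 * (2 * r + 3) * (2 ^ r * (1 / 2 ^ k))) := by gcongr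
              _ = _ := by rw [hBdef]; ring
        _ = B * (10 * 4 ^ u) * ∑ k ∈ Finset.Ioc u r, (1 / 2 ^ k : ℝ) := by rw [Finset.mul_sum]
        _ ≤ B * (10 * 4 ^ u) * (1 / 2 ^ u) := by
            refine mul_le_mul_of_nonneg_left ?_ (by positivity)
            have h := sum_one_div_two_pow_le hu
            have : (0 : ℝ) < 1 / 2 ^ r := by positivity
            linarith
        _ = B * (10 * 2 ^ u) := by
            rw [show (4 : ℝ) ^ u = 2 ^ u * 2 ^ u by rw [← mul_pow]; norm_num]
            field_simp
    push_cast
    calc _ ≤ B * (2 * 2 ^ u) + B * (10 * 2 ^ u) := add_le_add b1 b2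
      _ = _ := by rw [hBdef]; ring
  · simp [h3]
  · intro t ht1 ht2
    have : ∏ i ∈ Finset.Icc 1 (4 ^ u), g i t = 0 :=
      Finset.prod_eq_zero (Finset.mem_Icc.2 ⟨ht1, ht2⟩)
        (h5 t ht1 (ht2.trans (Nat.pow_le_pow_right (by norm_num) hu))).1
    beta_reduce
    rw [this, zero_mul]
  · intro t ht1 ht2
    have ht0 : 1 < t := (Nat.one_le_pow _ _ (by norm_num)).trans_lt ht1
    -- The least power of four not below t is a guess within a factor 4. Its searches alone give the
    -- bound; all other factors are at most 1.
    set k : ℕ := Nat.clog 4 t with hk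
    have hk1 : t ≤ 4 ^ k := Nat.le_pow_clog (by norm_num) t
    have hk2 : 4 ^ (k - 1) < t := Nat.pow_pred_clog_lt_self (by norm_num) ht0
    have huk : u < k := (Nat.pow_lt_pow_iff_right (by norm_num)).1 (ht1.trans_le hk1)
    have hkr : k ≤ r := (Nat.clog_le_iff_le_pow (by norm_num)).2 ht2
    have hkt : 4 ^ k ≤ 4 * t := by
      obtain ⟨l, hl⟩ : ∃ l, k = l + 1 := ⟨k - 1, by omega⟩
      rw [hl, Nat.add_sub_cancel] at hk2
      rw [hl, pow_succ]
      omega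
    have hg : g (4 ^ k) t ≤ 9 / 10 :=
      (h5 (4 ^ k) (Nat.one_le_pow _ _ (by norm_num))
        (Nat.pow_le_pow_right (by norm_num) hkr)).2 t hk1 hkt
    have e1 : ∏ i ∈ Finset.Icc 1 (4 ^ u), g i t ≤ 1 :=
      Finset.prod_le_one (fun i _ => (h4 i t).1) fun i _ => (h4 i t).2
    have e2 : ∏ k ∈ Finset.Ioc u r, g (4 ^ k) t ^ (10 * 4 ^ u) ≤
        g (4 ^ k) t ^ (10 * 4 ^ u) := by
      rw [← Finset.mul_prod_erase _ _ (Finset.mem_Ioc.2 ⟨huk, hkr⟩)]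
      refine mul_le_of_le_one_right (pow_nonneg (h4 _ _).1 _) ?_
      exact Finset.prod_le_one (fun i _ => pow_nonneg (h4 _ _).1 _)
        fun i _ => pow_le_one₀ (h4 _ _).1 (h4 _ _).2
    have e3 : (9 / 10 : ℝ) ≤ Real.exp (-(1 / 10)) := by
      have := Real.one_sub_le_exp_neg (1 / 10)
      linarith
    calc (∏ i ∈ Finset.Icc 1 (4 ^ u), g i t) *
          ∏ k ∈ Finset.Ioc u r, g (4 ^ k) t ^ (10 * 4 ^ u)
        ≤ 1 * g (4 ^ k) t ^ (10 * 4 ^ u) :=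
          mul_le_mul e1 e2 (Finset.prod_nonneg fun i _ => pow_nonneg (h4 _ _).1 _) zero_le_one
      _ = g (4 ^ k) t ^ (10 * 4 ^ u) := one_mul _
      _ ≤ Real.exp (-(1 / 10)) ^ (10 * 4 ^ u) := pow_le_pow_left₀ (h4 _ _).1 (hg.trans e3) _
      _ = Real.exp (-4 ^ u) := by
        rw [← Real.exp_nat_mul]
        congr 1
        push_cast
        ring

/-! ### From the search to the intersection function, and the constants -/

theorem exists_protocol_of_le {n r u : ℕ} (hn : n ≤ 4 ^ r) (hu : u ≤ r) {ε : ℝ} (hε : 0 ≤ ε)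
    (h : u < r → Real.exp (-4 ^ u) ≤ ε) :
    ∃ P : Protocol n, P.ErrsAtMost IN ε ∧
      (P.communication : ℝ) ≤ 72 * (2 * r + 3) * (2 ^ r * 2 ^ u) := by
  have hcard : Fintype.card (Fin n) ≤ Fintype.card (Fin (2 * r) → Bool) := by
    simpa [pow_mul] using hn
  obtain ⟨e⟩ := Function.Embedding.nonempty_of_card_le hcard
  obtain ⟨c, g, ⟨P, hc, hP⟩, hcost, h0, h1, h2⟩ := exists_combined_search hu e
  refine ⟨P, fun x y => ?_, hc ▸ hcost⟩
  cases hxy : IN x y with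
  | false =>
    have := P.outputProb_add x y
    rw [hP] at this
    beta_reduce at this
    rw [(commonCount_eq_zero_iff e.injective x y).2 hxy, h0] at this
    rw [Bool.not_false]
    linarith
  | true =>
    rw [Bool.not_true, hP]
    beta_reduce
    have ht : 1 ≤ commonCount e x y := by
      rw [Nat.one_le_iff_ne_zero]
      intro h'
      rw [commonCount_eq_zero_iff e.injective, hxy] at h'
      exact Bool.noConfusion h'
    have ht' : commonCount e x y ≤ 4 ^ r := by
      simpa [pow_mul] using commonCount_le e x y
    rcases le_or_gt (commonCount e x y) (4 ^ u) with hle | hgt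
    · rw [h1 _ ht hle]
      exact hε
    · exact (h2 _ hgt ht').trans
        (h ((Nat.pow_lt_pow_iff_right (by norm_num)).1 (hgt.trans_le ht')))

theorem exists_coin_protocol (n : ℕ) {ε : ℝ} (hε : 1 / 2 ≤ ε) :
    ∃ P : Protocol n, P.ErrsAtMost IN ε ∧ P.communication = 0 := by
  obtain ⟨P, hc, hP⟩ := computes_const (n := n) (p := 1 / 2) (by norm_num) (by norm_num)
  refine ⟨P, fun x y => ?_, hc⟩
  have := P.outputProb_add x y
  have h := hP x y
  cases IN x y
  · rw [Bool.not_false]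
    linarith
  · rw [Bool.not_true]
    linarith

/-- For L > 1 the power is below 4⌈L⌉ < 8L; otherwise it is 1. The constant 9 is a square, for the
later root. -/
theorem pow_clog_ceil_le {L : ℝ} (hL : 1 / 2 ≤ L) : (4 : ℝ) ^ Nat.clog 4 ⌈L⌉₊ ≤ 9 * L := by
  rcases Nat.lt_or_ge 1 ⌈L⌉₊ with h | h
  · have h1 : 1 < L := by simpa using Nat.lt_ceil.1 h
    have h2 : 4 ^ (Nat.clog 4 ⌈L⌉₊ - 1) < ⌈L⌉₊ :=
      Nat.pow_pred_clog_lt_self (by norm_num) h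
    have h3 : (⌈L⌉₊ : ℝ) < L + 1 := Nat.ceil_lt_add_one (by linarith)
    obtain ⟨l, hl⟩ : ∃ l, Nat.clog 4 ⌈L⌉₊ = l + 1 :=
      ⟨_, (Nat.succ_pred_eq_of_pos (Nat.clog_pos (by norm_num) h)).symm⟩
    rw [hl] at h2 ⊢
    have h4 : (4 : ℝ) ^ l < ⌈L⌉₊ := by exact_mod_cast h2
    rw [pow_succ]
    linarith
  · rw [Nat.clog_of_right_le_one h, pow_zero]
    linarith

theorem two_pow_le_sqrt {k : ℕ} {a b : ℝ} (ha : 0 ≤ a) (h : (4 : ℝ) ^ k ≤ a ^ 2 * b) :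
    (2 : ℝ) ^ k ≤ a * √b := by
  rw [← Real.sqrt_sq ha, ← Real.sqrt_mul (sq_nonneg a)]
  refine Real.le_sqrt_of_sq_le ?_
  rwa [← pow_mul, mul_comm, pow_mul, show (2 : ℝ) ^ 2 = 4 by norm_num]

end QComm

theorem theorem7 :
    ∃ C : ℝ, 0 < C ∧ ∀ n : ℕ, 2 ≤ n → ∀ ε : ℝ, 0 < ε → ε < 1 →
      ∃ P : QComm.Protocol n,
        P.ErrsAtMost QComm.IN ε ∧
        (P.communication : ℝ) ≤ C * (Real.sqrt (n * Real.log (1 / ε)) * Real.log n) := by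
  refine ⟨3888, by norm_num, fun n hn ε hε0 hε1 => ?_⟩
  have hn' : (2 : ℝ) ≤ n := by exact_mod_cast hn
  have hlog2 := Real.log_two_gt_d9
  have hlogn : Real.log 2 ≤ Real.log n := Real.log_le_log (by norm_num) hn'
  -- As ε tends to 1 the allowed communication tends to 0, so for ε ≥ 1/2 Bob tosses a fair coin.
  rcases le_or_gt (1 / 2) ε with hε | hε
  · obtain ⟨P, hP, hc⟩ := QComm.exists_coin_protocol n hε
    refine ⟨P, hP, ?_⟩
    rw [hc, Nat.cast_zero]
    have : 0 ≤ Real.log n := by linarith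
    positivity
  · set L : ℝ := Real.log (1 / ε) with hL
    have hL2 : Real.log 2 ≤ L := by
      refine Real.log_le_log (by norm_num) ?_
      rw [le_div_iff₀ hε0]
      linarith
    set r : ℕ := Nat.clog 4 n with hr
    set u₀ : ℕ := Nat.clog 4 ⌈L⌉₊ with hu₀
    have hnr : n ≤ 4 ^ r := Nat.le_pow_clog (by norm_num) n
    have hLu : L ≤ 4 ^ u₀ := by
      refine (Nat.le_ceil L).trans ?_
      exact_mod_cast Nat.le_pow_clog (by norm_num : 1 < 4) ⌈L⌉₊
    -- If the minimum is `r`, every possible number of marked addresses has its own exact search,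
    -- and no error bound is needed.
    obtain ⟨P, hP, hc⟩ := QComm.exists_protocol_of_le (u := min r u₀) hnr (min_le_left _ _)
      hε0.le fun h => by
        have : min r u₀ = u₀ := by omega
        rw [this, ← Real.exp_log hε0, Real.exp_le_exp]
        rw [hL, one_div, Real.log_inv] at hLu
        linarith
    refine ⟨P, hP, hc.trans ?_⟩
    obtain ⟨l, hl⟩ : ∃ l, r = l + 1 :=
      ⟨_, (Nat.succ_pred_eq_of_pos (Nat.clog_pos (by norm_num) (by omega))).symm⟩
    have hln : (4 : ℝ) ^ l < n := by
      have := Nat.pow_pred_clog_lt_self (b := 4) (by norm_num) (by omega : 1 < n)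
      rw [← hr, hl] at this
      exact_mod_cast this
    have b1 : (2 : ℝ) ^ r ≤ 2 * √n := by
      refine QComm.two_pow_le_sqrt (by norm_num) ?_
      rw [hl, pow_succ]
      linarith
    have b2 : (2 : ℝ) ^ min r u₀ ≤ 3 * √L := by
      refine (pow_le_pow_right₀ (by norm_num) (min_le_right _ _)).trans ?_
      refine QComm.two_pow_le_sqrt (by norm_num) ?_
      have := QComm.pow_clog_ceil_le (L := L) (by linarith)
      linarith
    -- Here 2r + 3 = 2l + 5 is at most 6 log n / log 2, and 6 / log 2 < 9.
    have b3 : 2 * (r : ℝ) + 3 ≤ 9 * Real.log n := by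
      have h1 : l * Real.log 4 ≤ Real.log n := by
        rw [← Real.log_pow]
        exact Real.log_le_log (by positivity) hln.le
      have h2 : Real.log 4 = 2 * Real.log 2 := by
        rw [show (4 : ℝ) = 2 ^ 2 by norm_num, Real.log_pow]
        norm_num
      have h3 : (0 : ℝ) ≤ l := l.cast_nonneg
      rw [h2] at h1
      rw [hl]
      push_cast
      nlinarith
    have hlog0 : 0 ≤ Real.log n := by linarith
    -- The constant is 3888 = 72 · 9 · 2 · 3.
    calc 72 * (2 * (r : ℝ) + 3) * (2 ^ r * 2 ^ min r u₀)
        ≤ 72 * (9 * Real.log n) * ((2 * √n) * (3 * √L)) := by gcongr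
      _ = 3888 * (√(n * L) * Real.log n) := by
        rw [Real.sqrt_mul (by linarith)]
        ring
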